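/- Let $n,p$ be positive integers. For $f:\mathbb{R}^{n\times p}\to\mathbb{R}\cup\{\infty\}$, $X\in\mathbb{R}^{n\times p}$ and $\rho\in\mathbb{R}^p$, let $$L(f:X,\rho)=\frac{1}{\Omega_n}\int_{S^{n-1}} f(X+e\rho^{\top})\,\mathrm{d}s(e),$$ where $S^{n-1}$ is the Euclidean unit sphere of $\mathbb{R}^n$, $\mathrm{d}s$ its surface area measure and $\Omega_n$ its total surface area. The function $f$ is called matrix superharmonic if (i) $f$ is lower semicontinuous, (ii) $f\not\equiv\infty$, and (iii) $L(f:X,\rho)\le f(X)$ for every $X\in\mathbb{R}^{n\times p}$ and every $\rho\in\mathbb{R}^p$. Theorem. Let $\alpha,\beta$ be real numbers with $-n-p+1\le\alpha\le-2p$ and $\beta\ge 0$. Then the function $$\pi_{\alpha,\beta}(M)=\det(M^{\top}M+\beta I_p)^{-(\alpha+n+p-1)/2},\qquad M\in\mathbb{R}^{n\times p},$$ is matrix superharmonic. Here, where the determinant is $0$ (which can happen only for $\beta=0$), the power is read as $\infty$ if its exponent is negative and as $1$ if its exponent is $0$. -/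

import Mathlib

open MeasureTheory

noncomputable section

/-- The surface area measure on the unit sphere of `ℝⁿ` (Euclidean norm); its total mass is the
surface area `Ω_n` of the unit sphere. For `n = 1` it is the counting measure on `{-1, 1}`. -/
def surfaceMeasure (n : ℕ) : Measure (Metric.sphere (0 : EuclideanSpace ℝ (Fin n)) 1) :=
  (volume : Measure (EuclideanSpace ℝ (Fin n))).toSphere

/-- The matrix `X + e ρᵀ`, a rank one perturbation of `X` in the direction of a unit vector `e`. -/
def rankOneShift {n p : ℕ} (X : Matrix (Fin n) (Fin p) ℝ) (ρ : Fin p → ℝ)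
    (e : Metric.sphere (0 : EuclideanSpace ℝ (Fin n)) 1) : Matrix (Fin n) (Fin p) ℝ :=
  X + Matrix.vecMulVec (fun a => (e : EuclideanSpace ℝ (Fin n)) a) ρ

/-- The average `L(f : X, ρ) = Ω_n⁻¹ ∫ f (X + e ρᵀ) ds(e)` over the unit sphere, as the average of
the positive part minus the average of the negative part. If `f` is lower semicontinuous with
values in `ℝ ∪ {∞}`, then `f` is bounded below on the (compact) set of all `X + e ρᵀ`, so that the
average of the negative part is finite and the difference is the usual integral in `ℝ ∪ {∞}`. -/
def rankOneAverage {n p : ℕ} (f : Matrix (Fin n) (Fin p) ℝ → EReal)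
    (X : Matrix (Fin n) (Fin p) ℝ) (ρ : Fin p → ℝ) : EReal :=
  ((⨍⁻ e, (f (rankOneShift X ρ e)).toENNReal ∂(surfaceMeasure n) : ENNReal) : EReal) -
    ((⨍⁻ e, (-f (rankOneShift X ρ e)).toENNReal ∂(surfaceMeasure n) : ENNReal) : EReal)

/-- Matrix superharmonicity of a function on `n × p` real matrices with values in `ℝ ∪ {∞}`
(an `EReal`-valued function that never takes the value `-∞`). -/
structure IsMatrixSuperharmonic {n p : ℕ} (f : Matrix (Fin n) (Fin p) ℝ → EReal) : Prop where
  ne_bot : ∀ X, f X ≠ ⊥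
  lowerSemicontinuous : LowerSemicontinuous f
  not_identically_top : ∃ X, f X ≠ ⊤
  average_le : ∀ (X : Matrix (Fin n) (Fin p) ℝ) (ρ : Fin p → ℝ), rankOneAverage f X ρ ≤ f X

/-- The prior `π_{α,β}(M) = det(MᵀM + β I_p) ^ (-(α + n + p - 1)/2)` with values in `[0, ∞]`.
For `β ≥ 0` the determinant is nonnegative. Where it vanishes, the power is `∞` if the exponent
is negative, and `1` if the exponent is zero. -/
def matrixTPrior (n p : ℕ) (α β : ℝ) (M : Matrix (Fin n) (Fin p) ℝ) : ENNReal :=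
  ENNReal.ofReal (M.transpose * M + β • (1 : Matrix (Fin p) (Fin p) ℝ)).det ^
    (-(α + (n : ℝ) + (p : ℝ) - 1) / 2)

end

/-! Write `s = (α + n + p - 1)/2`, so the bounds on `α` say exactly `0 ≤ s` and `2s + 1 ≤ n - p`.
For `β > 0` the function `g(y) = det(S(X + y uᵀ))^(-s)`, with `S(M) = MᵀM + βI`, is smooth on `ℝⁿ`,
and it suffices that it is superharmonic there. At `M = X + y uᵀ` put `a = uᵀS⁻¹u`, let `Mᵢ` be the
rows of `M`, and `cᵢ = uᵀS⁻¹Mᵢ`. A symmetric rank two update gives `det S(M + t eᵢuᵀ) = det S · ((1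
+ t cᵢ)² + t² kᵢ)` with `kᵢ = a(1 - MᵢᵀS⁻¹Mᵢ)`, so `Δg = 2s (det S)^(-s) ∑ᵢ ((2s + 1)cᵢ² - kᵢ)`.
Since `∑ cᵢ² ≤ a` and `∑ MᵢᵀS⁻¹Mᵢ ≤ p`, the sum is at most `a(2s + 1 - (n - p)) ≤ 0`
(`laplacian_det_shiftedGram_rpow_nonpos`). The mean value inequality
(`integral_sphere_le_of_laplacian_nonpos`) rests only on rotation invariance of the surface measure,
without the divergence theorem. The case `β = 0` follows by Fatou's lemma. -/

noncomputable section

/-! ### Rotation invariance of the surface measure and its infinitesimal form. -/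

section SphereIntegral

open Metric Set Filter Topology
open scoped Pointwise

variable {E : Type*} [NormedAddCommGroup E] [InnerProductSpace ℝ E]

/-- The action of a linear isometry equivalence on the unit sphere. -/
def sphereIsometry (L : E ≃ₗᵢ[ℝ] E) (e : sphere (0 : E) 1) : sphere (0 : E) 1 :=
  ⟨L e, by simp⟩

lemma continuous_sphereIsometry (L : E ≃ₗᵢ[ℝ] E) : Continuous (sphereIsometry L) :=
  Continuous.subtype_mk (L.continuous.comp continuous_subtype_val) _

/-- The surface measure of a set is a multiple of the volume of the cone over it, and a linear
isometry commutes with forming cones and preserves volume. -/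
lemma measurePreserving_sphereIsometry [MeasurableSpace E] [BorelSpace E] [FiniteDimensional ℝ E]
    (L : E ≃ₗᵢ[ℝ] E) :
    MeasurePreserving (sphereIsometry L) (volume : Measure E).toSphere
      (volume : Measure E).toSphere := by
  refine ⟨(continuous_sphereIsometry L).measurable, ?_⟩
  ext s hs
  have hs' := (continuous_sphereIsometry L).measurable hs
  rw [Measure.map_apply (continuous_sphereIsometry L).measurable hs,
    Measure.toSphere_apply' _ hs', Measure.toSphere_apply' _ hs]
  congr 1
  have h : Ioo (0 : ℝ) 1 • ((↑) '' (sphereIsometry L ⁻¹' s) : Set E)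
      = L ⁻¹' (Ioo (0 : ℝ) 1 • ((↑) '' s : Set E)) := by
    ext x
    simp only [Set.mem_smul, mem_image, mem_preimage]
    constructor
    · rintro ⟨t, ht, _, ⟨e, he, rfl⟩, rfl⟩
      exact ⟨t, ht, _, ⟨_, he, rfl⟩, by simp [sphereIsometry]⟩
    · rintro ⟨t, ht, _, ⟨e, he, rfl⟩, hx⟩
      refine ⟨t, ht, _, ⟨sphereIsometry L.symm e, ?_, rfl⟩, ?_⟩
      · simpa [sphereIsometry] using he
      · apply L.injective
        simpa [sphereIsometry] using hx
  rw [h, ← L.coe_toMeasurableEquiv]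
  exact (LinearIsometryEquiv.measurePreserving L).measure_preimage_equiv _

lemma integral_sphere_comp_isometry [MeasurableSpace E] [BorelSpace E] [FiniteDimensional ℝ E]
    (L : E ≃ₗᵢ[ℝ] E) {h : E → ℝ} (hh : Continuous h) :
    ∫ e : sphere (0 : E) 1, h (L e) ∂(volume : Measure E).toSphere
      = ∫ e : sphere (0 : E) 1, h e ∂(volume : Measure E).toSphere := by
  have hm := measurePreserving_sphereIsometry L
  conv_rhs => rw [← hm.map_eq]
  rw [integral_map hm.measurable.aemeasurable
    (by fun_prop : Continuous fun e : sphere (0 : E) 1 => h e).aestronglyMeasurable]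
  rfl

/-- Rotation by the angle `θ` in the plane of the orthonormal pair `u, v`. -/
def planeRotationLinear (u v : E) (θ : ℝ) : E →ₗ[ℝ] E where
  toFun x := x + ((Real.cos θ - 1) * inner ℝ u x - Real.sin θ * inner ℝ v x) • u
    + (Real.sin θ * inner ℝ u x + (Real.cos θ - 1) * inner ℝ v x) • v
  map_add' x y := by simp only [inner_add_right]; module
  map_smul' c x := by simp only [inner_smul_right, RingHom.id_apply]; module

lemma norm_planeRotationLinear {u v : E} (hu : ‖u‖ = 1) (hv : ‖v‖ = 1) (huv : inner ℝ u v = 0)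
    (θ : ℝ) (x : E) : ‖planeRotationLinear u v θ x‖ = ‖x‖ := by
  have hvu : inner ℝ v u = 0 := by rw [real_inner_comm]; exact huv
  have hsq : ‖planeRotationLinear u v θ x‖ ^ 2 = ‖x‖ ^ 2 := by
    rw [← real_inner_self_eq_norm_sq, ← real_inner_self_eq_norm_sq]
    simp only [planeRotationLinear, LinearMap.coe_mk, AddHom.coe_mk, inner_add_left,
      inner_add_right, inner_smul_left, inner_smul_right, huv, hvu, real_inner_self_eq_norm_sq,
      hu, hv, real_inner_comm x u, real_inner_comm x v, conj_trivial]
    rw [real_inner_comm u x, real_inner_comm v x]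
    have := Real.sin_sq_add_cos_sq θ
    linear_combination (inner ℝ u x ^ 2 + inner ℝ v x ^ 2) * this
  exact (sq_eq_sq₀ (norm_nonneg _) (norm_nonneg _)).1 hsq

/-- Rotation by the angle `θ` in the plane of an orthonormal pair, as an isometry. -/
def planeRotation [FiniteDimensional ℝ E] {u v : E} (hu : ‖u‖ = 1) (hv : ‖v‖ = 1)
    (huv : inner ℝ u v = 0) (θ : ℝ) : E ≃ₗᵢ[ℝ] E :=
  LinearIsometry.toLinearIsometryEquiv
    ⟨planeRotationLinear u v θ, norm_planeRotationLinear hu hv huv θ⟩ rfl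

lemma hasDerivAt_integral_of_continuous_deriv {K : Type*} [TopologicalSpace K] [CompactSpace K]
    [MeasurableSpace K] [OpensMeasurableSpace K] [SecondCountableTopology K]
    {μ : Measure K} [IsFiniteMeasure μ]
    {F F' : ℝ → K → ℝ} (hF : ∀ t, Continuous (F t)) (hF' : Continuous (Function.uncurry F'))
    (h : ∀ t k, HasDerivAt (fun t => F t k) (F' t k) t) (t : ℝ) :
    HasDerivAt (fun t => ∫ k, F t k ∂μ) (∫ k, F' t k ∂μ) t := by
  obtain ⟨C, hC⟩ := (isCompact_Icc.prod isCompact_univ :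
    IsCompact (Icc (t - 1) (t + 1) ×ˢ (univ : Set K))).exists_bound_of_continuousOn
      hF'.continuousOn
  have hFt : ∀ t, Continuous (F' t) := fun t => hF'.comp (by fun_prop : Continuous fun k => (t, k))
  have hint : ∀ f : K → ℝ, Continuous f → Integrable f μ := fun f hf =>
    hf.integrable_of_hasCompactSupport (HasCompactSupport.of_compactSpace f)
  exact (hasDerivAt_integral_of_dominated_loc_of_deriv_le (bound := fun _ => C)
    (Icc_mem_nhds (by linarith : t - 1 < t) (by linarith : t < t + 1))
    (Eventually.of_forall fun s => (hF s).aestronglyMeasurable) (hint _ (hF t))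
    (hFt t).aestronglyMeasurable
    (Eventually.of_forall fun k s hs => hC (s, k) ⟨hs, mem_univ _⟩)
    (integrable_const C) (Eventually.of_forall fun k s _ => h s k)).2

variable [MeasurableSpace E] [BorelSpace E] [FiniteDimensional ℝ E]

lemma integrable_sphere {h : sphere (0 : E) 1 → ℝ} (hh : Continuous h) :
    Integrable h (volume : Measure E).toSphere :=
  hh.integrable_of_hasCompactSupport (HasCompactSupport.of_compactSpace h)

/-- The integral over the sphere of the derivative along an infinitesimal rotation vanishes. -/
lemma integral_sphere_fderiv_rotation {u v : E} (hu : ‖u‖ = 1) (hv : ‖v‖ = 1)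
    (huv : inner ℝ u v = 0) {h : E → ℝ} (hh : ContDiff ℝ 1 h) :
    ∫ e : sphere (0 : E) 1, fderiv ℝ h e (inner ℝ u (e : E) • v - inner ℝ v (e : E) • u)
      ∂(volume : Measure E).toSphere = 0 := by
  have hR : ∀ (θ : ℝ) (x : E), planeRotation hu hv huv θ x =
      x + ((Real.cos θ - 1) * inner ℝ u x - Real.sin θ * inner ℝ v x) • u
    + (Real.sin θ * inner ℝ u x + (Real.cos θ - 1) * inner ℝ v x) • v := fun _ _ => rfl
  have hdR : ∀ (θ : ℝ) (x : E), HasDerivAt (fun θ => planeRotation hu hv huv θ x)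
      ((-Real.sin θ * inner ℝ u x - Real.cos θ * inner ℝ v x) • u
        + (Real.cos θ * inner ℝ u x + -Real.sin θ * inner ℝ v x) • v) θ := by
    intro θ x
    simp only [hR]
    have hc := (Real.hasDerivAt_cos θ).sub_const 1
    have hs := Real.hasDerivAt_sin θ
    have := (((hc.mul_const (inner ℝ u x)).sub (hs.mul_const (inner ℝ v x))).smul_const u).const_add x
    exact this.add (((hs.mul_const (inner ℝ u x)).add (hc.mul_const (inner ℝ v x))).smul_const v)
  have hfd : Continuous (fderiv ℝ h) := hh.continuous_fderiv one_ne_zero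
  have key := hasDerivAt_integral_of_continuous_deriv (μ := (volume : Measure E).toSphere)
    (F := fun θ (e : sphere (0 : E) 1) => h (planeRotation hu hv huv θ e))
    (F' := fun θ (e : sphere (0 : E) 1) => fderiv ℝ h (planeRotation hu hv huv θ e)
      ((-Real.sin θ * inner ℝ u (e : E) - Real.cos θ * inner ℝ v (e : E)) • u
        + (Real.cos θ * inner ℝ u (e : E) + -Real.sin θ * inner ℝ v (e : E)) • v))
    (fun θ => hh.continuous.comp ((planeRotation hu hv huv θ).continuous.comp
      continuous_subtype_val))
    (by
      unfold Function.uncurry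
      simp only [hR]
      refine (hfd.comp (by fun_prop)).clm_apply (by fun_prop))
    (fun θ e => ((hh.differentiable one_ne_zero _).hasFDerivAt.comp_hasDerivAt θ (hdR θ e))) 0
  -- By invariance the integral does not depend on `θ`, so its derivative at `0` vanishes.
  simp only [integral_sphere_comp_isometry _ hh.continuous] at key
  have := key.unique (hasDerivAt_const 0 _)
  rw [← this]
  refine integral_congr_ae (Eventually.of_forall fun e => ?_)
  have h0 : planeRotation hu hv huv 0 (e : E) = e := by simp [hR]
  simp only [h0]
  congr 1
  simp
  abel

end SphereIntegral

/-! ### The spherical mean value inequality for `C²` superharmonic functions. -/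

section MeanValue

open Metric Set Filter Topology

variable {E : Type*} [NormedAddCommGroup E] [InnerProductSpace ℝ E]
  {ι : Type*} [Fintype ι]

/-- In `integral_sphere_laplacian`, this collects the terms in which the rotation field
differentiates the coefficient `⟨bᵢ, x⟩`; `sum_rotation_bilinear` collects those in which it
differentiates the gradient. -/
lemma sum_rotation_linear (b : OrthonormalBasis ι ℝ E) (D : E →L[ℝ] ℝ) (x : E) :
    ∑ i, ∑ j, inner ℝ (b i) (inner ℝ (b i) x • b j - inner ℝ (b j) x • b i) * D (b j)
      = (1 - Fintype.card ι) * D x := by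
  classical
  have hx : ∑ j, inner ℝ (b j) x * D (b j) = D x := by
    conv_rhs => rw [← b.sum_repr' x]
    simp
  simp only [inner_sub_right, inner_smul_right, orthonormal_iff_ite.1 b.orthonormal, sub_mul,
    Finset.sum_sub_distrib, mul_ite, ite_mul, mul_zero, zero_mul, Finset.sum_ite_eq,
    Finset.mem_univ, if_true, mul_one, hx, Finset.sum_const, Finset.card_univ, nsmul_eq_mul, one_mul]

lemma sum_rotation_bilinear (b : OrthonormalBasis ι ℝ E) (B : E →L[ℝ] E →L[ℝ] ℝ) (x : E) :
    ∑ i, ∑ j, inner ℝ (b i) x * B (inner ℝ (b i) x • b j - inner ℝ (b j) x • b i) (b j)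
      = ‖x‖ ^ 2 * ∑ j, B (b j) (b j) - B x x := by
  have hx : ∑ i, ∑ j, inner ℝ (b i) x * (inner ℝ (b j) x * B (b i) (b j)) = B x x := by
    conv_rhs => rw [← b.sum_repr' x]
    simp only [map_sum, map_smul, sum_apply, smul_apply, smul_eq_mul, Finset.mul_sum]
    rw [Finset.sum_comm]
    exact Finset.sum_congr rfl fun i _ => Finset.sum_congr rfl fun j _ => by ring
  have hn : ‖x‖ ^ 2 = ∑ i, inner ℝ (b i) x * inner ℝ (b i) x := by
    rw [← real_inner_self_eq_norm_sq, ← b.sum_inner_mul_inner]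
    simp only [real_inner_comm]
  rw [← hx, hn, Finset.sum_mul_sum]
  simp only [map_sub, map_smul, sub_apply, smul_apply,
    smul_eq_mul, mul_sub, Finset.sum_sub_distrib, mul_assoc]

/-- The second derivative of `h ^ (-s)` in a direction along which `h` is quadratic. -/
lemma fderiv_fderiv_rpow_of_quadratic {h : E → ℝ} (hh : ContDiff ℝ 2 h) (hpos : ∀ x, 0 < h x)
    {s c k : ℝ} {x v : E} (hq : ∀ t : ℝ, h (x + t • v) = h x * ((1 + t * c) ^ 2 + t ^ 2 * k)) :
    fderiv ℝ (fderiv ℝ fun y => h y ^ (-s)) x v v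
      = 2 * s * h x ^ (-s) * ((2 * s + 1) * c ^ 2 - k) := by
  have hg : ContDiff ℝ 2 fun y => h y ^ (-s) := hh.rpow_const_of_ne fun y => (hpos y).ne'
  have hD : ContDiff ℝ 1 (fderiv ℝ fun y => h y ^ (-s)) := hg.fderiv_right (by norm_num)
  have hline : ∀ t : ℝ, HasDerivAt (fun t : ℝ => x + t • v) v t := fun t => by
    simpa using ((hasDerivAt_id t).smul_const v).const_add x
  set q : ℝ → ℝ := fun t => h x * ((1 + t * c) ^ 2 + t ^ 2 * k) with hqdef
  have hqpos : ∀ t, 0 < q t := fun t => by rw [hqdef]; dsimp only; rw [← hq]; exact hpos _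
  have hdq : ∀ t, HasDerivAt q (h x * (2 * (1 + t * c) * c + 2 * t * k)) t := by
    intro t
    have h1 : HasDerivAt (fun t : ℝ => 1 + t * c) c t := by
      simpa using ((hasDerivAt_id t).mul_const c).const_add 1
    have := ((h1.pow 2).add ((hasDerivAt_pow 2 t).mul_const k)).const_mul (h x)
    refine this.congr_deriv ?_
    simp
  have e1 : ∀ t : ℝ, fderiv ℝ (fun y => h y ^ (-s)) (x + t • v) v
      = h x * (2 * (1 + t * c) * c + 2 * t * k) * (-s) * q t ^ (-s - 1) := by
    intro t
    have A := (hg.differentiable two_ne_zero (x + t • v)).hasFDerivAt.comp_hasDerivAt t (hline t)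
    have B := (hdq t).rpow_const (p := -s) (Or.inl (hqpos t).ne')
    have : ((fun y => h y ^ (-s)) ∘ fun t : ℝ => x + t • v) = fun t => q t ^ (-s) := by
      funext t; simp [hqdef, hq]
    rw [this] at A
    exact A.unique B
  have A := (hD.differentiable one_ne_zero (x + (0 : ℝ) • v)).hasFDerivAt.comp_hasDerivAt 0
    (hline 0)
  have A' := A.clm_apply (hasDerivAt_const (0 : ℝ) v)
  have hlin : HasDerivAt (fun t : ℝ => h x * (2 * (1 + t * c) * c + 2 * t * k))
      (h x * (2 * c * c + 2 * k)) 0 := by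
    have h1 : HasDerivAt (fun t : ℝ => 1 + t * c) c 0 := by
      simpa using ((hasDerivAt_id (0 : ℝ)).mul_const c).const_add 1
    have h2 : HasDerivAt (fun t : ℝ => 2 * t * k) (2 * k) 0 := by
      simpa using ((hasDerivAt_id (0 : ℝ)).const_mul 2).mul_const k
    exact (((h1.const_mul 2).mul_const c).add h2).const_mul (h x)
  have B := (hlin.mul_const (-s)).mul
    ((hdq 0).rpow_const (p := -s - 1) (Or.inl (hqpos 0).ne'))
  have hfun : (fun t : ℝ => (fderiv ℝ (fun y => h y ^ (-s)) ∘ fun t : ℝ => x + t • v) t v)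
      = fun t => h x * (2 * (1 + t * c) * c + 2 * t * k) * (-s) * q t ^ (-s - 1) := by
    funext t; exact e1 t
  rw [hfun] at A'
  have key := A'.unique B
  simp only [zero_smul, add_zero, map_zero] at key
  rw [key]
  have hq0 : q 0 = h x := by simp [hqdef]
  have p1 : h x ^ (-s) = h x * h x ^ (-s - 1) := by
    rw [Real.rpow_sub_one (hpos x).ne']; field_simp [(hpos x).ne']
  have p2 : h x ^ (-s - 1) = h x * h x ^ (-s - 1 - 1) := by
    rw [Real.rpow_sub_one (hpos x).ne' (-s - 1)]; field_simp [(hpos x).ne']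
  rw [hq0, p1, p2]
  ring

variable [MeasurableSpace E] [BorelSpace E] [FiniteDimensional ℝ E]

/-- Integrate the derivative of `⟨bᵢ, x⟩ ∂ⱼg(r x)` along the rotation field of the plane `bᵢ, bⱼ`:
each integral is zero, and the sum over all `i, j` is this identity. It is the integrated polar form
of the Laplacian. -/
lemma integral_sphere_laplacian (b : OrthonormalBasis ι ℝ E) {g : E → ℝ} (hg : ContDiff ℝ 2 g)
    (r : ℝ) :
    (Fintype.card ι - 1) * ∫ e : sphere (0 : E) 1, fderiv ℝ g (r • (e : E)) e
        ∂(volume : Measure E).toSphere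
      + r * ∫ e : sphere (0 : E) 1, fderiv ℝ (fderiv ℝ g) (r • (e : E)) e e
        ∂(volume : Measure E).toSphere
      = r * ∫ e : sphere (0 : E) 1, ∑ i, fderiv ℝ (fderiv ℝ g) (r • (e : E)) (b i) (b i)
        ∂(volume : Measure E).toSphere := by
  have hD : ContDiff ℝ 1 (fderiv ℝ g) := hg.fderiv_right (by norm_num)
  have hDc : Continuous (fderiv ℝ g) := hD.continuous
  have hD2c : Continuous (fderiv ℝ (fderiv ℝ g)) := hD.continuous_fderiv one_ne_zero
  have hG : ∀ i j, ContDiff ℝ 1 fun x : E => inner ℝ (b i) x * fderiv ℝ g (r • x) (b j) := by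
    intro i j
    exact (contDiff_const.inner ℝ contDiff_id).mul
      ((hD.comp (contDiff_const_smul r)).clm_apply contDiff_const)
  have hfG : ∀ i j x w, fderiv ℝ (fun x : E => inner ℝ (b i) x * fderiv ℝ g (r • x) (b j)) x w
      = inner ℝ (b i) w * fderiv ℝ g (r • x) (b j)
        + r * (inner ℝ (b i) x * fderiv ℝ (fderiv ℝ g) (r • x) w (b j)) := by
    intro i j x w
    have h1 : HasFDerivAt (fun x : E => inner ℝ (b i) x) (innerSL ℝ (b i)) x :=
      (innerSL ℝ (b i)).hasFDerivAt
    have h2 : HasFDerivAt (fun x : E => fderiv ℝ g (r • x))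
        ((fderiv ℝ (fderiv ℝ g) (r • x)).comp (r • ContinuousLinearMap.id ℝ E)) x :=
      (hD.differentiable one_ne_zero _).hasFDerivAt.comp x ((hasFDerivAt_id x).const_smul r)
    have h3 := h1.mul (h2.clm_apply (hasFDerivAt_const (b j) x))
    refine (DFunLike.congr_fun h3.fderiv w).trans ?_
    simp
    ring
  have hzero : ∀ i j, ∫ e : sphere (0 : E) 1,
      fderiv ℝ (fun x : E => inner ℝ (b i) x * fderiv ℝ g (r • x) (b j)) e
        (inner ℝ (b i) (e : E) • b j - inner ℝ (b j) (e : E) • b i)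
      ∂(volume : Measure E).toSphere = 0 := by
    intro i j
    by_cases hij : i = j
    · subst hij; simp
    · exact integral_sphere_fderiv_rotation (b.norm_eq_one i) (b.norm_eq_one j)
        (b.orthonormal.2 hij) (hG i j)
  have hcont : ∀ i j, Continuous fun e : sphere (0 : E) 1 =>
      fderiv ℝ (fun x : E => inner ℝ (b i) x * fderiv ℝ g (r • x) (b j)) e
        (inner ℝ (b i) (e : E) • b j - inner ℝ (b j) (e : E) • b i) := by
    intro i j
    exact (((hG i j).continuous_fderiv one_ne_zero).comp continuous_subtype_val).clm_apply
      (by fun_prop)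
  have hsum : ∫ e : sphere (0 : E) 1, ∑ i, ∑ j,
      fderiv ℝ (fun x : E => inner ℝ (b i) x * fderiv ℝ g (r • x) (b j)) e
        (inner ℝ (b i) (e : E) • b j - inner ℝ (b j) (e : E) • b i)
      ∂(volume : Measure E).toSphere = 0 := by
    rw [integral_finsetSum _ fun i _ => integrable_sphere
      (continuous_finsetSum _ fun j _ => hcont i j)]
    refine Finset.sum_eq_zero fun i _ => ?_
    rw [integral_finsetSum _ fun j _ => integrable_sphere (hcont i j)]
    exact Finset.sum_eq_zero fun j _ => hzero i j
  have hpt : ∀ e : sphere (0 : E) 1, ∑ i, ∑ j,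
      fderiv ℝ (fun x : E => inner ℝ (b i) x * fderiv ℝ g (r • x) (b j)) e
        (inner ℝ (b i) (e : E) • b j - inner ℝ (b j) (e : E) • b i)
      = (1 - Fintype.card ι) * fderiv ℝ g (r • (e : E)) e
        + r * ((∑ i, fderiv ℝ (fderiv ℝ g) (r • (e : E)) (b i) (b i))
          - fderiv ℝ (fderiv ℝ g) (r • (e : E)) e e) := by
    intro e
    simp only [hfG, Finset.sum_add_distrib]
    rw [sum_rotation_linear]
    simp only [← Finset.mul_sum _ _ r]
    rw [sum_rotation_bilinear]
    simp
  have hDr : Continuous fun e : sphere (0 : E) 1 => fderiv ℝ g (r • (e : E)) :=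
    hDc.comp (by fun_prop)
  have hD2r : Continuous fun e : sphere (0 : E) 1 => fderiv ℝ (fderiv ℝ g) (r • (e : E)) :=
    hD2c.comp (by fun_prop)
  have i1 := integrable_sphere (hDr.clm_apply continuous_subtype_val)
  have i2 := integrable_sphere (continuous_finsetSum (Finset.univ : Finset ι)
    fun i _ => (hD2r.clm_apply (continuous_const (y := b i))).clm_apply
      (continuous_const (y := b i)))
  have i3 := integrable_sphere
    ((hD2r.clm_apply continuous_subtype_val).clm_apply continuous_subtype_val)
  have i4 : Integrable (fun e : sphere (0 : E) 1 =>
      ∑ i, fderiv ℝ (fderiv ℝ g) (r • (e : E)) (b i) (b i)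
        - fderiv ℝ (fderiv ℝ g) (r • (e : E)) e e) (volume : Measure E).toSphere := i2.sub i3
  simp only [hpt] at hsum
  rw [integral_add (i1.const_mul _) (i4.const_mul _), integral_const_mul,
    integral_const_mul, integral_sub i2 i3] at hsum
  linear_combination -hsum

/-- The spherical mean value inequality for superharmonic functions of class `C²`. -/
theorem integral_sphere_le_of_laplacian_nonpos (b : OrthonormalBasis ι ℝ E)
    (hι : 2 ≤ Fintype.card ι) {g : E → ℝ} (hg : ContDiff ℝ 2 g)
    (hΔ : ∀ x, ∑ i, fderiv ℝ (fderiv ℝ g) x (b i) (b i) ≤ 0) :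
    ∫ e : sphere (0 : E) 1, g e ∂(volume : Measure E).toSphere
      ≤ ∫ _e : sphere (0 : E) 1, g 0 ∂(volume : Measure E).toSphere := by
  have hD : ContDiff ℝ 1 (fderiv ℝ g) := hg.fderiv_right (by norm_num)
  have hDc : Continuous (fderiv ℝ g) := hD.continuous
  have hD2c : Continuous (fderiv ℝ (fderiv ℝ g)) := hD.continuous_fderiv one_ne_zero
  set φ : ℝ → ℝ := fun r => ∫ e : sphere (0 : E) 1, g (r • (e : E))
    ∂(volume : Measure E).toSphere with hφ
  set φ' : ℝ → ℝ := fun r => ∫ e : sphere (0 : E) 1, fderiv ℝ g (r • (e : E)) e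
    ∂(volume : Measure E).toSphere with hφ'
  set φ'' : ℝ → ℝ := fun r => ∫ e : sphere (0 : E) 1, fderiv ℝ (fderiv ℝ g) (r • (e : E)) e e
    ∂(volume : Measure E).toSphere with hφ''
  have hray : ∀ (r : ℝ) (e : E), HasDerivAt (fun r : ℝ => r • e) e r := fun r e => by
    simpa using (hasDerivAt_id r).smul_const e
  have d1 : ∀ r, HasDerivAt φ (φ' r) r := by
    refine hasDerivAt_integral_of_continuous_deriv
      (fun t => hg.continuous.comp (by fun_prop)) ?_ ?_
    · unfold Function.uncurry
      exact (hDc.comp (by fun_prop)).clm_apply (by fun_prop)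
    · intro t e
      exact (hg.differentiable two_ne_zero _).hasFDerivAt.comp_hasDerivAt t (hray t e)
  have d2 : ∀ r, HasDerivAt φ' (φ'' r) r := by
    refine hasDerivAt_integral_of_continuous_deriv
      (fun t => (hDc.comp (by fun_prop)).clm_apply (by fun_prop)) ?_ ?_
    · unfold Function.uncurry
      exact ((hD2c.comp (by fun_prop)).clm_apply (by fun_prop)).clm_apply (by fun_prop)
    · intro t e
      have h2 := (hD.differentiable one_ne_zero _).hasFDerivAt.comp_hasDerivAt t
        (hray t (e : E))
      simpa using h2.clm_apply (hasDerivAt_const t (e : E))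
  -- With dimension `m + 2` the weight `r ^ (m + 1)` turns the radial operator into a single
  -- derivative.
  obtain ⟨m, hm⟩ : ∃ m, Fintype.card ι = m + 2 := ⟨_, (Nat.sub_add_cancel hι).symm⟩
  have d3 : ∀ r, HasDerivAt (fun r => r ^ (m + 1) * φ' r)
      (r ^ (m + 1) * ∫ e : sphere (0 : E) 1,
        ∑ i, fderiv ℝ (fderiv ℝ g) (r • (e : E)) (b i) (b i)
        ∂(volume : Measure E).toSphere) r := by
    intro r
    refine ((hasDerivAt_pow (m + 1) r).mul (d2 r)).congr_deriv ?_
    have := integral_sphere_laplacian b hg r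
    rw [hm] at this
    push_cast at this ⊢
    simp only [hφ', hφ'']
    linear_combination r ^ m * this
  have a1 : AntitoneOn (fun r => r ^ (m + 1) * φ' r) (Ici 0) := by
    refine antitoneOn_of_deriv_nonpos (convex_Ici 0)
      (fun r _ => (d3 r).continuousAt.continuousWithinAt)
      (fun r _ => (d3 r).differentiableAt.differentiableWithinAt) fun r hr => ?_
    rw [(d3 r).deriv]
    rw [interior_Ici] at hr
    exact mul_nonpos_of_nonneg_of_nonpos (pow_nonneg (le_of_lt hr) _)
      (integral_nonpos fun e => hΔ _)
  -- The weighted derivative is antitone and vanishes at `r = 0`, because the exponent `m + 1` is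
  -- positive.
  have hneg : ∀ r, 0 < r → φ' r ≤ 0 := by
    intro r hr
    have := a1 (mem_Ici.2 le_rfl) (mem_Ici.2 hr.le) hr.le
    simp only [ne_eq, Nat.add_eq_zero_iff, one_ne_zero, and_false, not_false_eq_true, zero_pow,
      zero_mul] at this
    exact nonpos_of_mul_nonpos_right this (pow_pos hr _)
  have a2 : AntitoneOn φ (Ici 0) := by
    refine antitoneOn_of_deriv_nonpos (convex_Ici 0)
      (fun r _ => (d1 r).continuousAt.continuousWithinAt)
      (fun r _ => (d1 r).differentiableAt.differentiableWithinAt) fun r hr => ?_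
    rw [(d1 r).deriv]
    rw [interior_Ici] at hr
    exact hneg r hr
  have := a2 (mem_Ici.2 le_rfl) (mem_Ici.2 zero_le_one) zero_le_one
  simpa [hφ] using this

end MeanValue

/-! ### Determinants of shifted Gram matrices under rank one perturbations. -/

section GramDeterminant

open Matrix

variable {m k : Type*} [Fintype m] [DecidableEq k]

/-- The Gram matrix `MᵀM`, shifted by `β` times the identity. -/
def shiftedGram (β : ℝ) (M : Matrix m k ℝ) : Matrix k k ℝ := Mᵀ * M + β • 1

lemma shiftedGram_isSymm (β : ℝ) (M : Matrix m k ℝ) : (shiftedGram β M).IsSymm := by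
  simp [shiftedGram, IsSymm, transpose_add, transpose_mul]

/-- The term `t²|v|² u uᵀ` is split evenly between the two transposed summands, giving the form `u
cᵀ + c uᵀ`. -/
lemma shiftedGram_add_vecMulVec (β t : ℝ) (M : Matrix m k ℝ) (v : m → ℝ) (u : k → ℝ) :
    shiftedGram β (M + t • vecMulVec v u) = shiftedGram β M
      + (vecMulVec u (t • (v ᵥ* M) + (t ^ 2 * (v ⬝ᵥ v) / 2) • u)
        + vecMulVec (t • (v ᵥ* M) + (t ^ 2 * (v ⬝ᵥ v) / 2) • u) u) := by
  ext i j
  have h : ∀ a, (M a i + t * (v a * u i)) * (M a j + t * (v a * u j))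
      = M a i * M a j + t * u i * (v a * M a j) + t * u j * (v a * M a i)
        + t ^ 2 * u i * u j * (v a * v a) := fun a => by ring
  simp only [shiftedGram, Matrix.add_apply, Matrix.mul_apply, transpose_apply, Matrix.smul_apply,
    vecMulVec_apply, smul_eq_mul, Pi.add_apply, Pi.smul_apply, vecMul, dotProduct, h,
    Finset.sum_add_distrib, ← Finset.mul_sum]
  ring

variable [Fintype k]

/-- The matrix determinant lemma reduces this to a `2 × 2` determinant, whose diagonal entries agree
by symmetry of `S⁻¹`. -/
lemma det_add_symmetric_rank_two {S : Matrix k k ℝ} (hS : S.IsSymm) (hdet : IsUnit S.det)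
    (u c : k → ℝ) :
    (S + (vecMulVec u c + vecMulVec c u)).det
      = S.det * ((1 + u ⬝ᵥ S⁻¹ *ᵥ c) ^ 2 - (u ⬝ᵥ S⁻¹ *ᵥ u) * (c ⬝ᵥ S⁻¹ *ᵥ c)) := by
  have hUV : (of ![u, c])ᵀ * of ![c, u] = vecMulVec u c + vecMulVec c u := by
    ext i j
    simp [Matrix.mul_apply, Fin.sum_univ_two, vecMulVec_apply]
  have hSi : (S⁻¹)ᵀ = S⁻¹ := by rw [transpose_nonsing_inv, hS.eq]
  have hsymm : c ⬝ᵥ S⁻¹ *ᵥ u = u ⬝ᵥ S⁻¹ *ᵥ c := by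
    rw [dotProduct_mulVec, ← mulVec_transpose, hSi, dotProduct_comm]
  have hent : ∀ i j, (of ![c, u] * S⁻¹ * (of ![u, c])ᵀ) i j
      = ![c, u] i ⬝ᵥ S⁻¹ *ᵥ ![u, c] j := by
    intro i j
    rw [Matrix.mul_assoc]
    rfl
  rw [← hUV, det_add_mul _ _ hdet, det_fin_two]
  simp only [Matrix.add_apply, hent]
  simp only [cons_val_zero, cons_val_one, one_apply_eq, ne_eq, zero_ne_one, one_ne_zero,
    not_false_eq_true, one_apply_ne, hsymm]
  ring

lemma shiftedGram_posDef {β : ℝ} (hβ : 0 < β) (M : Matrix m k ℝ) : (shiftedGram β M).PosDef := by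
  have h1 : (Mᵀ * M).PosSemidef := by
    simpa [conjTranspose_eq_transpose_of_trivial] using posSemidef_conjTranspose_mul_self M
  exact PosDef.posSemidef_add h1 (PosDef.one.smul hβ)

/-- The cubic and quartic terms in `t` cancel, leaving the quadratic that
`fderiv_fderiv_rpow_of_quadratic` requires. -/
lemma det_shiftedGram_add_vecMulVec {β : ℝ} (hβ : 0 < β) (t : ℝ) (M : Matrix m k ℝ) (v : m → ℝ)
    (u : k → ℝ) :
    (shiftedGram β (M + t • vecMulVec v u)).det = (shiftedGram β M).det *
      ((1 + t * (u ⬝ᵥ (shiftedGram β M)⁻¹ *ᵥ (v ᵥ* M))) ^ 2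
        + t ^ 2 * ((u ⬝ᵥ (shiftedGram β M)⁻¹ *ᵥ u)
          * (v ⬝ᵥ v - (v ᵥ* M) ⬝ᵥ (shiftedGram β M)⁻¹ *ᵥ (v ᵥ* M)))) := by
  have hS := shiftedGram_isSymm β M
  have hSi : ((shiftedGram β M)⁻¹)ᵀ = (shiftedGram β M)⁻¹ := by
    rw [transpose_nonsing_inv, hS.eq]
  have hsymm : (v ᵥ* M) ⬝ᵥ (shiftedGram β M)⁻¹ *ᵥ u
      = u ⬝ᵥ (shiftedGram β M)⁻¹ *ᵥ (v ᵥ* M) := by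
    rw [dotProduct_mulVec, ← mulVec_transpose, hSi, dotProduct_comm]
  rw [shiftedGram_add_vecMulVec,
    det_add_symmetric_rank_two hS (shiftedGram_posDef hβ M).det_pos.ne'.isUnit]
  simp only [mulVec_add, mulVec_smul, dotProduct_add, add_dotProduct, dotProduct_smul,
    smul_dotProduct, smul_eq_mul, hsymm]
  ring

/-- With `z = S⁻¹u` the left side is `|Mz|²`, while the right side is `zᵀSz = |Mz|² + β|z|²`. -/
lemma sum_sq_dotProduct_inv_shiftedGram_le {β : ℝ} (hβ : 0 < β) (M : Matrix m k ℝ) (u : k → ℝ) :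
    ∑ i, (u ⬝ᵥ (shiftedGram β M)⁻¹ *ᵥ M i) ^ 2 ≤ u ⬝ᵥ (shiftedGram β M)⁻¹ *ᵥ u := by
  have hS := shiftedGram_isSymm β M
  have hSi : ((shiftedGram β M)⁻¹)ᵀ = (shiftedGram β M)⁻¹ := by
    rw [transpose_nonsing_inv, hS.eq]
  set z := (shiftedGram β M)⁻¹ *ᵥ u with hz
  have hSz : shiftedGram β M *ᵥ z = u := by
    rw [hz, mulVec_mulVec, mul_nonsing_inv _ (shiftedGram_posDef hβ M).det_pos.ne'.isUnit,
      one_mulVec]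
  have h1 : ∀ i, u ⬝ᵥ (shiftedGram β M)⁻¹ *ᵥ M i = (M *ᵥ z) i := by
    intro i
    rw [dotProduct_mulVec, ← mulVec_transpose, hSi, dotProduct_comm]
    rfl
  have h2 : u ⬝ᵥ z = (M *ᵥ z) ⬝ᵥ (M *ᵥ z) + β * (z ⬝ᵥ z) := by
    conv_lhs => rw [← hSz]
    rw [shiftedGram, add_mulVec, add_dotProduct, ← mulVec_mulVec, smul_mulVec, one_mulVec,
      smul_dotProduct, smul_eq_mul, dotProduct_comm (Mᵀ *ᵥ _), dotProduct_mulVec, vecMul_transpose]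
  rw [h2]
  simp only [h1]
  have : 0 ≤ β * (z ⬝ᵥ z) := mul_nonneg hβ.le (Finset.sum_nonneg fun i _ => mul_self_nonneg _)
  simp only [sq]
  exact le_add_of_nonneg_right this

/-- The sum is `tr(S⁻¹MᵀM) = tr(I - βS⁻¹)`, and `S⁻¹` has nonnegative trace. -/
lemma sum_dotProduct_inv_shiftedGram_le {β : ℝ} (hβ : 0 < β) (M : Matrix m k ℝ) :
    ∑ i, M i ⬝ᵥ (shiftedGram β M)⁻¹ *ᵥ M i ≤ Fintype.card k := by
  have h1 : ∑ i, M i ⬝ᵥ (shiftedGram β M)⁻¹ *ᵥ M i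
      = ((shiftedGram β M)⁻¹ * (Mᵀ * M)).trace := by
    rw [← Matrix.mul_assoc, trace_mul_comm, trace]
    rfl
  have h2 : Mᵀ * M = shiftedGram β M - β • 1 := by simp [shiftedGram]
  have h3 := mul_nonneg hβ.le (shiftedGram_posDef hβ M).inv.posSemidef.trace_nonneg
  rw [h1, h2, Matrix.mul_sub, nonsing_inv_mul _ (shiftedGram_posDef hβ M).det_pos.ne'.isUnit,
    Matrix.mul_smul, Matrix.mul_one, trace_sub, trace_one, trace_smul, smul_eq_mul]
  linarith

lemma continuous_det_shiftedGram :
    Continuous fun q : ℝ × Matrix m k ℝ => (shiftedGram q.1 q.2).det := by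
  unfold shiftedGram
  fun_prop

lemma contDiff_det_shiftedGram {n : ℕ} (β : ℝ) (X : Matrix (Fin n) k ℝ) (u : k → ℝ) :
    ContDiff ℝ 2 fun y : EuclideanSpace ℝ (Fin n) =>
      (shiftedGram β (X + vecMulVec (fun a => y a) u)).det := by
  simp only [det_apply, shiftedGram, Matrix.add_apply, Matrix.mul_apply, transpose_apply,
    Matrix.smul_apply, vecMulVec_apply]
  fun_prop

lemma laplacian_det_shiftedGram_rpow_nonpos {n : ℕ} {β : ℝ} (hβ : 0 < β)
    (X : Matrix (Fin n) k ℝ) (u : k → ℝ) {s : ℝ} (hs : 0 ≤ s)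
    (hs' : 2 * s + 1 ≤ (n : ℝ) - Fintype.card k) (y : EuclideanSpace ℝ (Fin n)) :
    ∑ i, fderiv ℝ (fderiv ℝ fun y : EuclideanSpace ℝ (Fin n) =>
        (shiftedGram β (X + vecMulVec (fun a => y a) u)).det ^ (-s)) y
        (EuclideanSpace.basisFun (Fin n) ℝ i) (EuclideanSpace.basisFun (Fin n) ℝ i) ≤ 0 := by
  set M := X + vecMulVec (fun a => y a) u with hM
  have hline : ∀ (i : Fin n) (t : ℝ), X + vecMulVec
      (fun a => (y + t • EuclideanSpace.basisFun (Fin n) ℝ i : EuclideanSpace ℝ (Fin n)) a) u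
      = M + t • vecMulVec (Pi.single i 1) u := by
    intro i t
    ext a j
    simp [hM, vecMulVec_apply, Pi.single_apply]
    split_ifs <;> ring
  have hsecond := fun i : Fin n => fderiv_fderiv_rpow_of_quadratic
    (contDiff_det_shiftedGram β X u)
    (fun y => (shiftedGram_posDef hβ _).det_pos) (s := s) (x := y)
    (v := EuclideanSpace.basisFun (Fin n) ℝ i)
    (fun t => by rw [hline i t]; exact det_shiftedGram_add_vecMulVec hβ t M (Pi.single i 1) u)
  have hrow : ∀ i : Fin n, (Pi.single i 1 : Fin n → ℝ) ᵥ* M = M i := fun i => by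
    rw [single_one_vecMul]; rfl
  have hone : ∀ i : Fin n, (Pi.single i 1 : Fin n → ℝ) ⬝ᵥ Pi.single i 1 = 1 := by simp
  simp only [hsecond, hrow, hone, ← Finset.mul_sum, Finset.sum_sub_distrib, Finset.sum_const,
    Finset.card_univ, Fintype.card_fin, nsmul_eq_mul, mul_one]
  have hpos : 0 ≤ (shiftedGram β M).det ^ (-s) :=
    Real.rpow_nonneg (shiftedGram_posDef hβ M).det_pos.le _
  have ha := sum_sq_dotProduct_inv_shiftedGram_le hβ M u
  have htr := sum_dotProduct_inv_shiftedGram_le hβ M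
  have ha0 : 0 ≤ u ⬝ᵥ (shiftedGram β M)⁻¹ *ᵥ u :=
    (Finset.sum_nonneg fun i _ => sq_nonneg _).trans ha
  refine mul_nonpos_of_nonneg_of_nonpos (by positivity) (sub_nonpos.2 ?_)
  calc _ ≤ (2 * s + 1) * (u ⬝ᵥ (shiftedGram β M)⁻¹ *ᵥ u) :=
        mul_le_mul_of_nonneg_left ha (by linarith)
    _ = (u ⬝ᵥ (shiftedGram β M)⁻¹ *ᵥ u) * (2 * s + 1) := mul_comm _ _
    _ ≤ _ := mul_le_mul_of_nonneg_left (by linarith) ha0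

end GramDeterminant

/-! ### Superharmonicity of the prior, for positive and then for nonnegative shift. -/

section Prior

open Metric Filter Topology

variable {n p : ℕ}

lemma matrixTPrior_eq_det_shiftedGram (α β : ℝ) (M : Matrix (Fin n) (Fin p) ℝ) :
    matrixTPrior n p α β M
      = ENNReal.ofReal (shiftedGram β M).det ^ (-(α + (n : ℝ) + (p : ℝ) - 1) / 2) := rfl

/-- A real power is continuous on all of `[0, ∞]`, including at determinant `0`. Continuity in `M`
gives lower semicontinuity; continuity in `β` serves the limit to `β = 0`. -/
lemma Continuous.matrixTPrior {T : Type*} [TopologicalSpace T] (α : ℝ) {b : T → ℝ}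
    {M : T → Matrix (Fin n) (Fin p) ℝ} (hb : Continuous b) (hM : Continuous M) :
    Continuous fun x => matrixTPrior n p α (b x) (M x) := by
  simp only [matrixTPrior_eq_det_shiftedGram]
  exact ENNReal.continuous_rpow_const.comp
    (ENNReal.continuous_ofReal.comp (continuous_det_shiftedGram.comp (hb.prodMk hM)))

lemma continuous_rankOneShift (X : Matrix (Fin n) (Fin p) ℝ) (ρ : Fin p → ℝ) :
    Continuous (rankOneShift X ρ) := by
  refine continuous_matrix fun i j => ?_
  simp only [rankOneShift, Matrix.add_apply, Matrix.vecMulVec_apply]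
  fun_prop

lemma rankOneAverage_coe_ennreal (f : Matrix (Fin n) (Fin p) ℝ → ENNReal)
    (X : Matrix (Fin n) (Fin p) ℝ) (ρ : Fin p → ℝ) :
    rankOneAverage (fun M => (f M : EReal)) X ρ
      = ((⨍⁻ e, f (rankOneShift X ρ e) ∂(surfaceMeasure n) : ENNReal) : EReal) := by
  have h : ∀ x : ENNReal, (-(x : EReal)).toENNReal = 0 := fun x =>
    EReal.toENNReal_of_nonpos (EReal.neg_le_zero.2 (EReal.coe_ennreal_nonneg x))
  simp only [rankOneAverage, h, EReal.toENNReal_coe, laverage_zero, EReal.coe_ennreal_zero, sub_zero]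

instance : IsFiniteMeasure (surfaceMeasure n) := by
  unfold surfaceMeasure; infer_instance

lemma surfaceMeasure_ne_zero (hn : 0 < n) : surfaceMeasure n ≠ 0 := by
  have : Nonempty (Fin n) := ⟨⟨0, hn⟩⟩
  exact Measure.toSphere_ne_zero _

lemma lintegral_matrixTPrior_le_of_pos {α β : ℝ} (hβ : 0 < β) (hn : 2 ≤ n)
    (hα : -(n : ℝ) - (p : ℝ) + 1 ≤ α) (hα' : α ≤ -2 * (p : ℝ))
    (X : Matrix (Fin n) (Fin p) ℝ) (ρ : Fin p → ℝ) :
    ∫⁻ e, matrixTPrior n p α β (rankOneShift X ρ e) ∂(surfaceMeasure n)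
      ≤ matrixTPrior n p α β X * surfaceMeasure n Set.univ := by
  set s : ℝ := (α + n + p - 1) / 2 with hs
  set g : EuclideanSpace ℝ (Fin n) → ℝ := fun y =>
    (shiftedGram β (X + Matrix.vecMulVec (fun a => y a) ρ)).det ^ (-s) with hg
  have hpos : ∀ M : Matrix (Fin n) (Fin p) ℝ, 0 < (shiftedGram β M).det := fun M =>
    (shiftedGram_posDef hβ M).det_pos
  have hgpos : ∀ y, 0 ≤ g y := fun y => Real.rpow_nonneg (hpos _).le _
  have hgc : ContDiff ℝ 2 g :=
    (contDiff_det_shiftedGram β X ρ).rpow_const_of_ne fun y => (hpos _).ne'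
  have hprior : ∀ M : Matrix (Fin n) (Fin p) ℝ, matrixTPrior n p α β M
      = ENNReal.ofReal ((shiftedGram β M).det ^ (-s)) := by
    intro M
    rw [matrixTPrior_eq_det_shiftedGram, ENNReal.ofReal_rpow_of_pos (hpos M), hs, neg_div]
  have hshift : ∀ e, matrixTPrior n p α β (rankOneShift X ρ e) = ENNReal.ofReal (g e) :=
    fun e => hprior _
  have hX : matrixTPrior n p α β X = ENNReal.ofReal (g 0) := by
    rw [hprior, hg]
    congr 4
    ext i j
    simp [Matrix.vecMulVec_apply]
  simp only [hshift, hX]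
  rw [← lintegral_const, surfaceMeasure,
    ← ofReal_integral_eq_lintegral_ofReal (f := fun e : sphere (0 : EuclideanSpace ℝ (Fin n)) 1 => g e)
      (integrable_sphere (hgc.continuous.comp continuous_subtype_val)) (Eventually.of_forall fun e => hgpos _),
    ← ofReal_integral_eq_lintegral_ofReal (integrable_sphere continuous_const)
      (Eventually.of_forall fun e => hgpos _)]
  refine ENNReal.ofReal_le_ofReal (integral_sphere_le_of_laplacian_nonpos
    (EuclideanSpace.basisFun (Fin n) ℝ) (by simpa using hn) hgc fun y => ?_)
  -- The lower bound on `α` gives `0 ≤ s`; the upper bound gives `2s + 1 = α + n + p ≤ n - p`.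
  refine laplacian_det_shiftedGram_rpow_nonpos hβ X ρ (by linarith) ?_ y
  rw [Fintype.card_fin]
  linarith

/-- Approximate `β` by the positive shifts `β + 1/(k + 1)` and apply Fatou's lemma; no domination is
needed. -/
lemma lintegral_matrixTPrior_le {α β : ℝ} (hβ : 0 ≤ β) (hn : 2 ≤ n)
    (hα : -(n : ℝ) - (p : ℝ) + 1 ≤ α) (hα' : α ≤ -2 * (p : ℝ))
    (X : Matrix (Fin n) (Fin p) ℝ) (ρ : Fin p → ℝ) :
    ∫⁻ e, matrixTPrior n p α β (rankOneShift X ρ e) ∂(surfaceMeasure n)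
      ≤ matrixTPrior n p α β X * surfaceMeasure n Set.univ := by
  have hlim : ∀ M : Matrix (Fin n) (Fin p) ℝ, Tendsto
      (fun k : ℕ => matrixTPrior n p α (β + 1 / ((k : ℝ) + 1)) M) atTop
      (𝓝 (matrixTPrior n p α β M)) := by
    intro M
    have h1 : Tendsto (fun k : ℕ => β + 1 / ((k : ℝ) + 1)) atTop (𝓝 β) := by
      simpa using tendsto_one_div_add_atTop_nhds_zero_nat.const_add β
    have h2 : Continuous fun b : ℝ => matrixTPrior n p α b M :=
      continuous_id.matrixTPrior α continuous_const
    exact (h2.tendsto β).comp h1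
  have hmeas : ∀ k : ℕ, Measurable fun e =>
      matrixTPrior n p α (β + 1 / ((k : ℝ) + 1)) (rankOneShift X ρ e) := fun k =>
    (continuous_const.matrixTPrior α (continuous_rankOneShift X ρ)).measurable
  calc ∫⁻ e, matrixTPrior n p α β (rankOneShift X ρ e) ∂(surfaceMeasure n)
      = ∫⁻ e, liminf (fun k : ℕ => matrixTPrior n p α (β + 1 / ((k : ℝ) + 1))
          (rankOneShift X ρ e)) atTop ∂(surfaceMeasure n) :=
        lintegral_congr fun e => (hlim _).liminf_eq.symm
    _ ≤ liminf (fun k : ℕ => ∫⁻ e, matrixTPrior n p α (β + 1 / ((k : ℝ) + 1))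
          (rankOneShift X ρ e) ∂(surfaceMeasure n)) atTop := lintegral_liminf_le hmeas
    _ ≤ liminf (fun k : ℕ => matrixTPrior n p α (β + 1 / ((k : ℝ) + 1)) X
          * surfaceMeasure n Set.univ) atTop :=
        liminf_le_liminf (Eventually.of_forall fun k =>
          lintegral_matrixTPrior_le_of_pos (by positivity) hn hα hα' X ρ)
    _ = matrixTPrior n p α β X * surfaceMeasure n Set.univ :=
        (ENNReal.Tendsto.mul_const (hlim X) (Or.inr (measure_ne_top _ _))).liminf_eq

lemma exists_matrixTPrior_ne_top {α β : ℝ} (hβ : 0 ≤ β) (hpn : p ≤ n) :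
    ∃ M, matrixTPrior n p α β M ≠ ⊤ := by
  -- A matrix with orthonormal columns has determinant `(1 + β)^p > 0`, even for `β = 0`.
  refine ⟨Matrix.of fun i j => if i = Fin.castLE hpn j then 1 else 0, ?_⟩
  have h : shiftedGram β (Matrix.of fun (i : Fin n) (j : Fin p) =>
      if i = Fin.castLE hpn j then (1 : ℝ) else 0) = (1 + β) • (1 : Matrix (Fin p) (Fin p) ℝ) := by
    ext i j
    simp [shiftedGram, Matrix.mul_apply, Matrix.one_apply, eq_comm]
    split_ifs <;> simp
  rw [matrixTPrior_eq_det_shiftedGram, h, Matrix.det_smul, Matrix.det_one]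
  refine ENNReal.rpow_ne_top_of_ne_zero ?_ ENNReal.ofReal_ne_top
  have : 0 < (1 + β) ^ Fintype.card (Fin p) * 1 := by positivity
  simpa using this

end Prior

end

theorem mainTheorem4 (n p : ℕ) (α β : ℝ) (hα : -(n : ℝ) - (p : ℝ) + 1 ≤ α)
    (hα' : α ≤ -2 * (p : ℝ)) (hβ : 0 ≤ β) :
    IsMatrixSuperharmonic
      (fun M : Matrix (Fin n) (Fin p) ℝ => ((matrixTPrior n p α β M : ENNReal) : EReal)) := by
  -- The interval for `α` is nonempty only if `-n - p + 1 ≤ -2p`.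
  have hpn : p + 1 ≤ n := by
    have : (p : ℝ) + 1 ≤ n := by linarith
    exact_mod_cast this
  refine ⟨fun X => EReal.coe_ennreal_ne_bot _, ?_, ?_, fun X ρ => ?_⟩
  · refine Continuous.lowerSemicontinuous (continuous_coe_ennreal_ereal.comp ?_)
    exact continuous_const.matrixTPrior α continuous_id
  · obtain ⟨M, hM⟩ := exists_matrixTPrior_ne_top (n := n) (p := p) (α := α) hβ (by omega)
    exact ⟨M, by simpa using hM⟩
  · have : NeZero (surfaceMeasure n) := ⟨surfaceMeasure_ne_zero (by omega)⟩
    rw [rankOneAverage_coe_ennreal, EReal.coe_ennreal_le_coe_ennreal_iff]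
    -- For `p = 0` the dimension `n` may be `1`, outside the mean value inequality, but there is
    -- only one matrix. For `p ≥ 1`, `n ≥ 2`.
    rcases Nat.eq_zero_or_pos p with rfl | hp
    · have h : ∀ e, rankOneShift X ρ e = X := fun e => Subsingleton.elim _ _
      simp only [h, laverage_const, le_refl]
    · rw [laverage_eq]
      exact ENNReal.div_le_of_le_mul (lintegral_matrixTPrior_le hβ (by omega) hα hα' X ρ)
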